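/- **Theorem.** Let $(T,d)$ be a compact $\mathbb{R}$-tree, i.e. a compact (nonempty) connected geodesic metric space with $d(x,y)+d(z,t)\le\max[d(x,z)+d(y,t),\,d(x,t)+d(y,z)]$ for all $x,y,z,t\in T$. Let $$\overline{\dim}\,T:=\limsup_{\varepsilon\to0^+}\frac{\log \mathcal N_T(\varepsilon)}{\log(1/\varepsilon)}$$ be its upper box dimension, where $\mathcal N_T(\varepsilon)$ is the minimal number of balls of radius $\varepsilon$ covering $T$, and suppose that $\overline{\dim}\,T<\infty$. For a continuous $f:[0,1]\to\mathbb{R}$ let $T_f$ be the metric space obtained from $[0,1]$ by identifying points at distance $0$ for the pseudo-distance $$d_f(x,y):=f(x)+f(y)-2\sup_{\gamma:x\mapsto y}\ \inf_{t\in[0,1]}f(\gamma(t)),$$ the supremum being over all paths $\gamma$ in $[0,1]$ from $x$ to $y$. For $p>0$, the $p$-variation of $f$ is $\big(\sup_D\sum_k|f(t_k)-f(t_{k-1})|^p\big)^{1/p}$, the supremum being over all finite partitions $D=(t_k)$ of $[0,1]$. Then there is a continuous function $f:[0,1]\to\mathbb{R}$ such that $T_f$ is isometric to $T$ and such that, for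 every $\delta>0$: 1. $f$ has finite $(\overline{\dim}\,T+\delta)$-variation; 2. there is a homeomorphism $\varphi:[0,1]\to[0,1]$ such that $T_{f\circ\varphi}$ is isometric to $T$ and $f\circ\varphi$ is $\frac{1}{\overline{\dim}\,T+\delta}$-Hölder continuous. -/

import Mathlib

open Set Filter Topology
open scoped ENNReal NNReal unitInterval

noncomputable section

/-- An `ℝ`-tree: a connected geodesic metric space satisfying Gromov's four-point condition. -/
structure IsRTree (T : Type*) [MetricSpace T] : Prop where
  connected : ConnectedSpace T
  geodesic : ∀ x y : T, ∃ γ : ℝ → T, γ 0 = x ∧ γ (dist x y) = y ∧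
    ∀ s ∈ Icc 0 (dist x y), ∀ t ∈ Icc 0 (dist x y), dist (γ s) (γ t) = |s - t|
  four_point : ∀ x y z t : T,
    dist x y + dist z t ≤ max (dist x z + dist y t) (dist x t + dist y z)

/-- The upper box dimension `limsup_{ε → 0⁺} log N(ε) / log (1/ε)`, where `N(ε)` is the minimal
number of closed balls of radius `ε` needed to cover the space. The value lies in `[-∞, ∞]`; it is
nonnegative as soon as the space is nonempty. -/
def upperBoxDim (X : Type*) [PseudoMetricSpace X] : EReal :=
  limsup (fun ε : ℝ≥0 =>
    ENNReal.log ((Metric.coveringNumber ε (univ : Set X) : ℕ∞) : ℝ≥0∞) /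
      ((Real.log (1 / (ε : ℝ)) : ℝ) : EReal)) (𝓝[>] 0)

/-- The `p`-variation `(sup_D ∑_k |f (t_{k+1}) - f (t_k)| ^ p) ^ (1 / p)` of `f : [0,1] → ℝ`
(for `p > 0`), where `D` runs over all finite sequences `t_0 ≤ t_1 ≤ ⋯ ≤ t_n` in `[0,1]`. -/
def pVariation (p : ℝ) (f : I → ℝ) : ℝ≥0∞ :=
  (⨆ D : ℕ × {t : ℕ → I // Monotone t},
    ∑ k ∈ Finset.range D.1, edist (f (D.2.1 (k + 1))) (f (D.2.1 k)) ^ p) ^ (1 / p)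

instance : PathConnectedSpace I :=
  isPathConnected_iff_pathConnectedSpace.1
    ((convex_Icc (0 : ℝ) 1).isPathConnected ⟨0, by simp⟩)

section SuperlevelTree

variable {X : Type*} [TopologicalSpace X]

/-- `sup_{γ : x ↦ y} inf_{t ∈ [0,1]} f (γ t)`, over all paths `γ` from `x` to `y`. -/
def pathHeight (f : C(X, ℝ)) (x y : X) : ℝ :=
  ⨆ γ : Path x y, ⨅ t : I, f (γ t)

/-- The `H₀`-pseudo-distance `d_f`. -/
def h0Dist (f : C(X, ℝ)) (x y : X) : ℝ :=
  f x + f y - 2 * pathHeight f x y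

instance [PathConnectedSpace X] (x y : X) : Nonempty (Path x y) :=
  PathConnectedSpace.joined x y

theorem bddBelow_path (f : C(X, ℝ)) {x y : X} (γ : Path x y) :
    BddBelow (range fun t : I => f (γ t)) :=
  (isCompact_range (f.continuous.comp γ.continuous)).bddBelow

theorem iInf_path_le (f : C(X, ℝ)) {x y : X} (γ : Path x y) (t : I) :
    ⨅ t : I, f (γ t) ≤ f (γ t) :=
  ciInf_le (bddBelow_path f γ) t

theorem bddAbove_pathHeight (f : C(X, ℝ)) (x y : X) :
    BddAbove (range fun γ : Path x y => ⨅ t : I, f (γ t)) := by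
  refine ⟨f x, ?_⟩
  rintro _ ⟨γ, rfl⟩
  simpa using iInf_path_le f γ 0

theorem le_pathHeight (f : C(X, ℝ)) {x y : X} (γ : Path x y) :
    ⨅ t : I, f (γ t) ≤ pathHeight f x y :=
  le_ciSup (bddAbove_pathHeight f x y) γ

theorem pathHeight_le_left [PathConnectedSpace X] (f : C(X, ℝ)) (x y : X) :
    pathHeight f x y ≤ f x :=
  ciSup_le fun γ => by simpa using iInf_path_le f γ 0

theorem pathHeight_le_right [PathConnectedSpace X] (f : C(X, ℝ)) (x y : X) :
    pathHeight f x y ≤ f y :=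
  ciSup_le fun γ => by simpa using iInf_path_le f γ 1

theorem pathHeight_self [PathConnectedSpace X] (f : C(X, ℝ)) (x : X) :
    pathHeight f x x = f x := by
  refine le_antisymm (pathHeight_le_left f x x) ?_
  simpa using le_pathHeight f (Path.refl x)

theorem pathHeight_comm [PathConnectedSpace X] (f : C(X, ℝ)) (x y : X) :
    pathHeight f x y = pathHeight f y x := by
  have key : ∀ a b : X, pathHeight f a b ≤ pathHeight f b a := fun a b =>
    ciSup_le fun γ => (le_ciInf fun t => by
      simpa [Path.symm_apply] using iInf_path_le f γ (unitInterval.symm t)).trans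
        (le_pathHeight f γ.symm)
  exact le_antisymm (key x y) (key y x)

theorem min_pathHeight_le [PathConnectedSpace X] (f : C(X, ℝ)) (x z y : X) :
    min (pathHeight f x z) (pathHeight f z y) ≤ pathHeight f x y := by
  refine le_of_forall_lt fun c hc => ?_
  obtain ⟨h1, h2⟩ := lt_min_iff.1 hc
  obtain ⟨γ, hγ⟩ := exists_lt_of_lt_ciSup h1
  obtain ⟨η, hη⟩ := exists_lt_of_lt_ciSup h2
  refine (lt_min hγ hη).trans_le (le_trans (le_ciInf fun t => ?_) (le_pathHeight f (γ.trans η)))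
  have ht : (γ.trans η) t ∈ range γ ∪ range η := by
    rw [← Path.trans_range]; exact mem_range_self t
  rcases ht with ⟨s, hs⟩ | ⟨s, hs⟩
  · rw [← hs]; exact (min_le_left _ _).trans (iInf_path_le f γ s)
  · rw [← hs]; exact (min_le_right _ _).trans (iInf_path_le f η s)

theorem h0Dist_self [PathConnectedSpace X] (f : C(X, ℝ)) (x : X) : h0Dist f x x = 0 := by
  rw [h0Dist, pathHeight_self]; ring

theorem h0Dist_comm [PathConnectedSpace X] (f : C(X, ℝ)) (x y : X) :
    h0Dist f x y = h0Dist f y x := by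
  rw [h0Dist, h0Dist, pathHeight_comm f x y]; ring

theorem h0Dist_triangle [PathConnectedSpace X] (f : C(X, ℝ)) (x z y : X) :
    h0Dist f x y ≤ h0Dist f x z + h0Dist f z y := by
  have h := min_pathHeight_le f x z y
  have h1 := pathHeight_le_right f x z
  have h2 := pathHeight_le_left f z y
  unfold h0Dist
  rcases min_le_iff.1 h with h | h <;> linarith

/-- A copy of `X`, to carry the pseudo-distance `d_f`. -/
def H0Space (_f : C(X, ℝ)) : Type _ := X

instance [PathConnectedSpace X] (f : C(X, ℝ)) : PseudoMetricSpace (H0Space f) where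
  dist := h0Dist (X := X) f
  dist_self := h0Dist_self f
  dist_comm := h0Dist_comm f
  dist_triangle := h0Dist_triangle f

/-- The tree `T_f = X / {d_f = 0}`, with the distance induced by `d_f`. -/
abbrev H0Tree [PathConnectedSpace X] (f : C(X, ℝ)) : Type _ :=
  SeparationQuotient (H0Space f)

end SuperlevelTree

end

/-! Root T at ρ and write (x|y) for the Gromov product, the height at which the geodesics from ρ to
x and to y separate. Explore T by a surjection g from [0,1] obeying the contour relation and let f t
= dist ρ (g t). The minimum of f between s and t is then (g s|g t), so d_f(s,t) = dist (g s) (g t)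
and T_f is T (`IsRTree.pathHeight_eq_gromovProduct`).

Regularity depends on the speed of exploration. During an increment of size ε, either the arrival
point is at distance at least ε/2 from all points visited up to the departure, or the departure
point is at distance at least ε/2 from all points visited from the arrival on. Points of each kind
are separated, so the number of disjoint increments of size 2⁻ᵏ is at most 2 N_k, with N_k the
covering number at radius 2⁻ᵏ⁻³ (`Crossings.exists_separated`). A clock charging about 1/(k² N_k)
for each has finite total time (`exists_clock`). Since N_k = O(2^(kq)) for q above the dimension, g
is 1/p-Hölder for every p > 0 above it.

Finite walks are built by inserting points into lists; g is a limit of the walks run with their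
clocks (`IsRTree.exists_contour`). -/

noncomputable section

/-! ### Gromov products and the contour relation -/

/-- The Gromov product of `x` and `y` based at `ρ`. -/
def gromovProduct {X : Type*} [PseudoMetricSpace X] (ρ x y : X) : ℝ :=
  (dist ρ x + dist ρ y - dist x y) / 2

section GromovProduct

variable {X : Type*} [PseudoMetricSpace X] (ρ x y : X)

theorem gromovProduct_comm : gromovProduct ρ x y = gromovProduct ρ y x := by
  rw [gromovProduct, gromovProduct, dist_comm x y]; ring

theorem gromovProduct_self : gromovProduct ρ x x = dist ρ x := by
  rw [gromovProduct, dist_self]; ring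

theorem gromovProduct_le_left : gromovProduct ρ x y ≤ dist ρ x := by
  have := dist_triangle ρ x y
  rw [gromovProduct]; linarith

theorem gromovProduct_le_right : gromovProduct ρ x y ≤ dist ρ y := by
  rw [gromovProduct_comm]; exact gromovProduct_le_left ρ y x

theorem dist_eq_gromovProduct : dist x y = dist ρ x + dist ρ y - 2 * gromovProduct ρ x y := by
  rw [gromovProduct]; ring

theorem continuous_gromovProduct : Continuous fun p : X × X => gromovProduct ρ p.1 p.2 := by
  unfold gromovProduct; fun_prop

end GromovProduct

/-- The relation between three points `x, y, z` met in this order by a contour exploration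
started at `ρ`. -/
def ContourRel {X : Type*} [PseudoMetricSpace X] (ρ x y z : X) : Prop :=
  gromovProduct ρ x z ≤ gromovProduct ρ x y ∧ gromovProduct ρ x z ≤ gromovProduct ρ y z

theorem ContourRel.symm {X : Type*} [PseudoMetricSpace X] {ρ x y z : X}
    (h : ContourRel ρ x y z) : ContourRel ρ z y x := by
  rw [ContourRel, gromovProduct_comm ρ z x, gromovProduct_comm ρ z y, gromovProduct_comm ρ y x]
  exact And.symm h

theorem contourRel_left {X : Type*} [PseudoMetricSpace X] (ρ x z : X) : ContourRel ρ x x z := by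
  refine ⟨?_, le_rfl⟩
  rw [gromovProduct_self]; exact gromovProduct_le_left ρ x z

theorem contourRel_right {X : Type*} [PseudoMetricSpace X] (ρ x z : X) : ContourRel ρ x z z :=
  (contourRel_left ρ z x).symm

/-- A family of points of `X` satisfying the contour relation for the order of the indices. -/
def IsContour {X : Type*} [PseudoMetricSpace X] (ρ : X) {ι : Type*} [Preorder ι] (v : ι → X) :
    Prop :=
  ∀ ⦃i j k : ι⦄, i ≤ j → j ≤ k → ContourRel ρ (v i) (v j) (v k)

/-! ### Finite contour walks in an ℝ-tree -/

section RTree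

variable {T : Type*} [MetricSpace T]

/-- The four-point condition with ρ among the four points. This ultrametric inequality and its
isosceles form below are the only uses made of the condition. -/
theorem IsRTree.min_gromovProduct_le (hT : IsRTree T) (ρ x y z : T) :
    min (gromovProduct ρ x y) (gromovProduct ρ y z) ≤ gromovProduct ρ x z := by
  have h := hT.four_point x z y ρ
  have h1 := dist_comm x ρ
  have h2 := dist_comm y ρ
  have h3 := dist_comm z ρ
  have h4 := dist_comm z y
  unfold gromovProduct
  rw [min_le_iff]
  rcases le_max_iff.1 h with h | h
  · left; linarith
  · right; linarith

theorem IsRTree.gromovProduct_eq_min (hT : IsRTree T) {ρ x u i : T}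
    (h : gromovProduct ρ i x ≤ gromovProduct ρ u x) :
    gromovProduct ρ i x = min (gromovProduct ρ i u) (gromovProduct ρ u x) := by
  refine le_antisymm (le_min ?_ h) (hT.min_gromovProduct_le ρ i u x)
  have := hT.min_gromovProduct_le ρ i x u
  rwa [gromovProduct_comm ρ x u, min_eq_left h] at this

/-- By the isosceles property the products of x with the rest of the list are determined by those of
u (`e₁`, `e₂`), so every relation involving x reduces to one involving u. -/
theorem IsRTree.triplewise_insert_after (hT : IsRTree T) {ρ u x : T} {L₁ L₂ : List T}
    (hL : (L₁ ++ u :: L₂).Triplewise (ContourRel ρ))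
    (h₁ : ∀ i ∈ L₁, gromovProduct ρ i x ≤ gromovProduct ρ u x)
    (h₂ : ∀ j ∈ L₂, gromovProduct ρ j x ≤ gromovProduct ρ u x)
    (h₃ : ∀ j ∈ L₂, gromovProduct ρ u j ≤ gromovProduct ρ u x) :
    (L₁ ++ u :: x :: L₂).Triplewise (ContourRel ρ) := by
  have e₁ : ∀ i ∈ L₁, gromovProduct ρ i x = min (gromovProduct ρ i u) (gromovProduct ρ u x) :=
    fun i hi => hT.gromovProduct_eq_min (h₁ i hi)
  have e₂ : ∀ j ∈ L₂, gromovProduct ρ x j = gromovProduct ρ u j := fun j hj => by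
    rw [gromovProduct_comm, hT.gromovProduct_eq_min (h₂ j hj), gromovProduct_comm ρ j u,
      min_eq_left (h₃ j hj)]
  simp only [List.triplewise_append, List.triplewise_cons, List.pairwise_cons,
    List.forall_mem_cons] at hL ⊢
  obtain ⟨hL₁, ⟨hu, hL₂⟩, h12, hu1, h21⟩ := hL
  refine ⟨hL₁, ⟨⟨fun j hj => ⟨h₃ j hj, (e₂ j hj).ge⟩, hu⟩, ?_, hL₂⟩, fun a ha => ⟨⟨?_, ?_⟩, ?_, ?_⟩,
    hu1, ?_, h21⟩
  · refine hu.imp_of_mem fun {i j} hi hj hij => ?_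
    rw [ContourRel, e₂ i hi, e₂ j hj]
    exact hij
  · rw [ContourRel, e₁ a ha]
    exact ⟨min_le_left _ _, min_le_right _ _⟩
  · exact (h12 a ha).1
  · intro j hj
    have := (h12 a ha).1 j hj
    rw [ContourRel, e₁ a ha, e₂ j hj]
    exact ⟨le_min this.1 (this.2.trans (h₃ j hj)), this.2⟩
  · exact (h12 a ha).2
  · refine hu1.imp_of_mem fun {i j} hi hj hij => ?_
    rw [ContourRel, e₁ i hi, e₁ j hj]
    exact ⟨(min_le_left _ _).trans hij.1, min_le_min_right _ hij.2⟩

theorem triplewise_contourRel_reverse {ρ : T} {L : List T}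
    (hL : L.Triplewise (ContourRel ρ)) : L.reverse.Triplewise (ContourRel ρ) :=
  List.triplewise_reverse.2 (hL.imp fun h => h.symm)

/-- A point can be added to a contour list, after the last point branching the latest from it. -/
theorem IsRTree.exists_triplewise_insert (hT : IsRTree T) {ρ x : T} {L : List T}
    (hL : L.Triplewise (ContourRel ρ)) :
    ∃ L' : List T, L'.Triplewise (ContourRel ρ) ∧ L ⊆ L' ∧ x ∈ L' := by
  -- u is the last maximiser of the product with x. The strict inequality after u yields (u|j) ≤
  -- (u|x) at the end of the proof.
  have key : ∀ L : List T, L ≠ [] → ∃ L₁ u L₂, L = L₁ ++ u :: L₂ ∧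
      (∀ i ∈ L₁, gromovProduct ρ i x ≤ gromovProduct ρ u x) ∧
      (∀ j ∈ L₂, gromovProduct ρ j x < gromovProduct ρ u x) := by
    intro L
    induction L with
    | nil => simp
    | cons a L ih =>
      intro _
      rcases eq_or_ne L [] with rfl | hne
      · exact ⟨[], a, [], by simp⟩
      obtain ⟨L₁, u, L₂, rfl, h₁, h₂⟩ := ih hne
      rcases le_or_gt (gromovProduct ρ a x) (gromovProduct ρ u x) with h | h
      · exact ⟨a :: L₁, u, L₂, by simp, by simpa using ⟨h, h₁⟩, h₂⟩
      · refine ⟨[], a, L₁ ++ u :: L₂, by simp, by simp, fun j hj => ?_⟩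
        rcases List.mem_append.1 hj with hj | hj
        · exact (h₁ j hj).trans_lt h
        · rcases List.mem_cons.1 hj with rfl | hj
          · exact h
          · exact (h₂ j hj).trans h
  rcases eq_or_ne L [] with rfl | hne
  · exact ⟨[x], by simp, by simp, by simp⟩
  obtain ⟨L₁, u, L₂, rfl, h₁, h₂⟩ := key L hne
  refine ⟨L₁ ++ u :: x :: L₂, hT.triplewise_insert_after hL h₁ (fun j hj => (h₂ j hj).le)
    fun j hj => ?_, fun y => by simp; tauto, by simp⟩
  have h := h₂ j hj
  rw [hT.gromovProduct_eq_min h.le, min_lt_iff] at h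
  rw [gromovProduct_comm ρ u j]
  exact (h.resolve_right (lt_irrefl _)).le

theorem IsRTree.exists_triplewise_of_finset (hT : IsRTree T) (ρ : T) (S : Finset T) :
    ∃ L : List T, L.Triplewise (ContourRel ρ) ∧ ∀ x ∈ S, x ∈ L := by
  classical
  induction S using Finset.induction_on with
  | empty => exact ⟨[], by simp, by simp⟩
  | insert a S _ ih =>
    obtain ⟨L, hL, hS⟩ := ih
    obtain ⟨L', hL', hsub, ha⟩ := hT.exists_triplewise_insert (x := a) hL
    exact ⟨L', hL', by simpa using ⟨ha, fun x hx => hsub (hS x hx)⟩⟩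

/-- A point of a geodesic between two successive points can be added to a contour list. -/
theorem IsRTree.triplewise_insert_between (hT : IsRTree T) {ρ u w y : T} {L₁ L₂ : List T}
    (hL : (L₁ ++ u :: w :: L₂).Triplewise (ContourRel ρ))
    (hy : dist u y + dist y w = dist u w) :
    (L₁ ++ u :: y :: w :: L₂).Triplewise (ContourRel ρ) := by
  have huw : ∀ j ∈ w :: L₂, gromovProduct ρ u j ≤ gromovProduct ρ u w := by
    have := hL
    simp only [List.triplewise_append, List.triplewise_cons, List.pairwise_cons] at this
    intro j hj
    rcases List.mem_cons.1 hj with rfl | hj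
    · exact le_rfl
    · exact (this.2.1.1.1 j hj).1
  have hwu : ∀ i ∈ L₁ ++ [u], gromovProduct ρ w i ≤ gromovProduct ρ w u := by
    have := hL
    simp only [List.triplewise_append, List.triplewise_cons, List.pairwise_cons,
      List.forall_mem_cons] at this
    intro j hj
    rcases List.mem_append.1 hj with hj | hj
    · rw [gromovProduct_comm ρ w j, gromovProduct_comm ρ w u]
      exact ((this.2.2.1 j hj).1.1).2
    · rw [List.mem_singleton.1 hj]
  have e : dist ρ y + gromovProduct ρ u w = gromovProduct ρ u y + gromovProduct ρ y w := by
    unfold gromovProduct; linarith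
  have l1 := gromovProduct_le_right ρ u y
  have l2 := gromovProduct_le_left ρ y w
  -- By `e` and the ultrametric inequality, (y|w) or (u|y) equals dist ρ y: y is an ancestor of w or
  -- of u. It is inserted next to that descendant, on the reversed list in the first case.
  rcases min_le_iff.1 (hT.min_gromovProduct_le ρ u y w) with h | h
  · have hyw : gromovProduct ρ w y = dist ρ y := by rw [gromovProduct_comm]; linarith
    have hrev := triplewise_contourRel_reverse hL
    have := hT.triplewise_insert_after (ρ := ρ) (u := w) (x := y) (L₁ := L₂.reverse)
      (L₂ := u :: L₁.reverse) (by simpa using hrev)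
      (fun i _ => by rw [hyw]; exact gromovProduct_le_right ρ i y)
      (fun i _ => by rw [hyw]; exact gromovProduct_le_right ρ i y)
      (fun i hi => by
        have h1 := hwu i (by simpa [or_comm] using hi)
        rw [gromovProduct_comm ρ w u] at h1
        linarith)
    simpa using triplewise_contourRel_reverse this
  · have huy : gromovProduct ρ u y = dist ρ y := by linarith
    exact hT.triplewise_insert_after hL
      (fun i _ => by rw [huy]; exact gromovProduct_le_right ρ i y)
      (fun i _ => by rw [huy]; exact gromovProduct_le_right ρ i y)
      (fun i hi => by have h1 := huw i hi; linarith)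

theorem IsRTree.exists_between (hT : IsRTree T) (u w : T) {r : ℝ} (h₀ : 0 ≤ r)
    (h₁ : r ≤ dist u w) : ∃ y, dist u y = r ∧ dist u y + dist y w = dist u w := by
  obtain ⟨γ, hγ0, hγ1, hγ⟩ := hT.geodesic u w
  have a0 : (0 : ℝ) ∈ Icc 0 (dist u w) := ⟨le_rfl, dist_nonneg⟩
  have a1 : dist u w ∈ Icc 0 (dist u w) := ⟨dist_nonneg, le_rfl⟩
  have h2 := hγ 0 a0 r ⟨h₀, h₁⟩
  have h3 := hγ r ⟨h₀, h₁⟩ _ a1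
  rw [hγ0] at h2
  rw [hγ1] at h3
  rw [zero_sub, abs_neg, abs_of_nonneg h₀] at h2
  rw [abs_sub_comm, abs_of_nonneg (by linarith)] at h3
  exact ⟨γ r, h2, by linarith⟩

/-- Refinement of a contour list into one with small steps. -/
theorem IsRTree.exists_triplewise_isChain (hT : IsRTree T) {ρ : T} {η : ℝ} (hη : 0 < η)
    (L₂ : List T) : ∀ (L₁ : List T) (u : T), (L₁ ++ u :: L₂).Triplewise (ContourRel ρ) →
      (L₁ ++ [u]).IsChain (fun x y => dist x y ≤ η) →
      ∃ L : List T, L.Triplewise (ContourRel ρ) ∧ L.IsChain (fun x y => dist x y ≤ η) ∧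
        L₁ ++ u :: L₂ ⊆ L := by
  induction L₂ with
  | nil => exact fun L₁ u hL hc => ⟨_, hL, hc, List.Subset.refl _⟩
  | cons w L₂ ih =>
    -- Induction on the number of steps of length η needed to reach w from u; each inserts the point
    -- of the geodesic at distance η from u.
    have key : ∀ (N : ℕ) (L₁ : List T) (u : T), dist u w ≤ (N + 1 : ℕ) * η →
        (L₁ ++ u :: w :: L₂).Triplewise (ContourRel ρ) →
        (L₁ ++ [u]).IsChain (fun x y => dist x y ≤ η) →
        ∃ L : List T, L.Triplewise (ContourRel ρ) ∧ L.IsChain (fun x y => dist x y ≤ η) ∧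
          L₁ ++ u :: w :: L₂ ⊆ L := by
      have step : ∀ (L₁ : List T) (u w : T), dist u w ≤ η →
          (L₁ ++ [u]).IsChain (fun x y => dist x y ≤ η) →
          (L₁ ++ [u] ++ [w]).IsChain (fun x y => dist x y ≤ η) := by
        intro L₁ u w huw hc
        rw [List.append_assoc]
        simp only [List.singleton_append]
        rw [List.isChain_append_cons_cons]
        exact ⟨hc, huw, by simp⟩
      intro N
      induction N with
      | zero =>
        intro L₁ u hd hL hc
        obtain ⟨L, h1, h2, h3⟩ := ih (L₁ ++ [u]) w (by simpa using hL)
          (step L₁ u w (by simpa using hd) hc)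
        exact ⟨L, h1, h2, by simpa using h3⟩
      | succ N ihN =>
        intro L₁ u hd hL hc
        rcases le_or_gt (dist u w) η with h | h
        · exact ihN L₁ u (h.trans (by push_cast; nlinarith [hη, N.cast_nonneg (α := ℝ)])) hL hc
        obtain ⟨y, hy1, hy2⟩ := hT.exists_between u w hη.le h.le
        obtain ⟨L, h1, h2, h3⟩ := ihN (L₁ ++ [u]) y
          (by push_cast at hd ⊢; linarith)
          (by simpa using hT.triplewise_insert_between hL hy2) (step L₁ u y hy1.le hc)
        refine ⟨L, h1, h2, fun a ha => h3 ?_⟩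
        simp only [List.mem_append, List.mem_cons, List.append_assoc, List.singleton_append] at ha ⊢
        tauto
    intro L₁ u
    obtain ⟨N, hN⟩ := exists_nat_ge (dist u w / η)
    refine key N L₁ u ?_
    rw [div_le_iff₀ hη] at hN
    push_cast; nlinarith

/-- A compact `ℝ`-tree is explored, up to `η`, by a finite contour walk with steps at most `η`. -/
theorem IsRTree.exists_isContour [CompactSpace T] (hT : IsRTree T) (ρ : T) {η : ℝ} (hη : 0 < η) :
    ∃ (v : ℕ → T) (M : ℕ), IsContour ρ v ∧ (∀ i, dist (v i) (v (i + 1)) ≤ η) ∧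
      ∀ x, ∃ i ≤ M, dist x (v i) ≤ η := by
  obtain ⟨S, -, hSf, hS⟩ := (isCompact_univ (X := T)).finite_cover_balls hη
  obtain ⟨L₀, hL₀, hSL₀⟩ := hT.exists_triplewise_of_finset ρ hSf.toFinset
  have hne : ∀ x : T, ∃ y ∈ L₀, dist x y ≤ η := fun x => by
    obtain ⟨y, hy, hxy⟩ := mem_iUnion₂.1 (hS (mem_univ x))
    exact ⟨y, hSL₀ y (by simpa using hy), (Metric.mem_ball.1 hxy).le⟩
  obtain ⟨L, hL, hc, hsub⟩ : ∃ L : List T, L.Triplewise (ContourRel ρ) ∧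
      L.IsChain (fun x y => dist x y ≤ η) ∧ L₀ ⊆ L := by
    rcases L₀ with _ | ⟨u, L₂⟩
    · exact ⟨[], by simp, by simp, by simp⟩
    · exact hT.exists_triplewise_isChain hη L₂ [] u hL₀ (by simp)
  have hlen : 0 < L.length := by
    obtain ⟨y, hy, -⟩ := hne ρ
    exact List.length_pos_of_mem (hsub hy)
  have hlt : ∀ i, min i (L.length - 1) < L.length := fun i => by omega
  -- The last point is repeated forever. Repeated indices give degenerate triples, for which the
  -- contour relation is automatic.
  refine ⟨fun i => L[min i (L.length - 1)]'(hlt i), L.length, ?_, ?_, ?_⟩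
  · intro i j k hij hjk
    have h1 : min i (L.length - 1) ≤ min j (L.length - 1) := by omega
    have h2 : min j (L.length - 1) ≤ min k (L.length - 1) := by omega
    rcases h1.eq_or_lt with h1 | h1
    · simp only [h1]; exact contourRel_left _ _ _
    rcases h2.eq_or_lt with h2 | h2
    · simp only [h2]; exact contourRel_right _ _ _
    exact List.triplewise_iff_getElem.1 hL _ _ _ h1 h2 (hlt k)
  · intro i
    rcases lt_or_ge (i + 1) L.length with h | h
    · have e1 : min i (L.length - 1) = i := by omega
      have e2 : min (i + 1) (L.length - 1) = i + 1 := by omega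
      simp only [e1, e2]
      exact List.isChain_iff_getElem.1 hc i h
    · have e : min i (L.length - 1) = min (i + 1) (L.length - 1) := by omega
      simp only [e, dist_self]; exact hη.le
  · intro x
    obtain ⟨y, hy, hxy⟩ := hne x
    obtain ⟨i, hi, rfl⟩ := List.getElem_of_mem (hsub hy)
    refine ⟨i, hi.le, ?_⟩
    have e1 : min i (L.length - 1) = i := by omega
    simpa only [e1] using hxy

end RTree

/-! ### Counting large increments; the clock -/

/-- `Crossings v ε n j` means that the sequence `v` makes, up to time `j`, at least `n` increments
of size at least `ε` over non-overlapping intervals of times. -/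
inductive Crossings {X : Type*} [PseudoMetricSpace X] (v : ℕ → X) (ε : ℝ) : ℕ → ℕ → Prop
  | zero (j : ℕ) : Crossings v ε 0 j
  | mono {n i j : ℕ} : Crossings v ε n i → i ≤ j → Crossings v ε n j
  | succ {n i j : ℕ} : Crossings v ε n i → i ≤ j → ε ≤ dist (v i) (v j) →
      Crossings v ε (n + 1) j

section Crossings

variable {X : Type*} [PseudoMetricSpace X] {ρ : X} {v : ℕ → X} {ε : ℝ} {n j : ℕ}

/-- An increment splits at height (v i|v j) into a descent from v i and an ascent to v j, one of
length at least ε/2. After a long ascent v j is far from the past and joins A; after a long descent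
v i is far from the future and joins B. -/
theorem Crossings.exists_separated (hv : IsContour ρ v) (hε : 0 < ε) (h : Crossings v ε n j) :
    ∃ A B : Finset X, A.card + B.card = n ∧
      (A : Set X).Pairwise (fun x y => ε / 2 ≤ dist x y) ∧
      (B : Set X).Pairwise (fun x y => ε / 2 ≤ dist x y) ∧
      (∀ x ∈ A, ∃ c ≤ j, v c = x) ∧ ∀ x ∈ B, ∀ c, j ≤ c → ε / 2 ≤ dist x (v c) := by
  classical
  induction h with
  | zero j => exact ⟨∅, ∅, by simp, by simp, by simp, by simp, by simp⟩
  | mono _ hij ih =>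
    obtain ⟨A, B, hn, hA, hB, hAj, hBj⟩ := ih
    refine ⟨A, B, hn, hA, hB, fun x hx => ?_, fun x hx c hc => hBj x hx c (hij.trans hc)⟩
    obtain ⟨c, hc, rfl⟩ := hAj x hx
    exact ⟨c, hc.trans hij, rfl⟩
  | @succ n i j _ hij hd ih =>
    obtain ⟨A, B, hn, hA, hB, hAj, hBj⟩ := ih
    have hsplit : ε / 2 ≤ dist ρ (v j) - gromovProduct ρ (v i) (v j) ∨
        ε / 2 ≤ dist ρ (v i) - gromovProduct ρ (v i) (v j) := by
      rw [dist_eq_gromovProduct ρ] at hd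
      by_contra! hcon
      linarith [hcon.1, hcon.2]
    have hAj' : ∀ x ∈ A, ∃ c ≤ j, v c = x := fun x hx => by
      obtain ⟨c, hc, rfl⟩ := hAj x hx
      exact ⟨c, hc.trans hij, rfl⟩
    rcases hsplit with h | h
    · have hnew : ∀ x ∈ A, ε / 2 ≤ dist (v j) x := fun x hx => by
        obtain ⟨c, hc, rfl⟩ := hAj x hx
        have h1 := (hv hc hij).2
        have h2 := gromovProduct_le_left ρ (v c) (v j)
        rw [dist_comm, dist_eq_gromovProduct ρ]
        linarith
      have hmem : v j ∉ A := fun hmem => by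
        have := hnew _ hmem
        rw [dist_self] at this
        linarith
      refine ⟨insert (v j) A, B, by rw [Finset.card_insert_of_notMem hmem]; omega, ?_, hB, ?_,
        fun x hx c hc => hBj x hx c (hij.trans hc)⟩
      · rw [Finset.coe_insert, Set.pairwise_insert]
        exact ⟨hA, fun x hx _ => ⟨hnew x hx, by rw [dist_comm]; exact hnew x hx⟩⟩
      · intro x hx
        rcases Finset.mem_insert.1 hx with rfl | hx
        · exact ⟨j, le_rfl, rfl⟩
        · exact hAj' x hx
    · have hnew : ∀ c, j ≤ c → ε / 2 ≤ dist (v i) (v c) := fun c hc => by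
        have h1 := (hv hij hc).1
        have h2 := gromovProduct_le_right ρ (v i) (v c)
        rw [dist_eq_gromovProduct ρ]
        linarith
      have hmem : v i ∉ B := fun hmem => by
        have := hBj _ hmem i le_rfl
        rw [dist_self] at this
        linarith
      refine ⟨A, insert (v i) B, by rw [Finset.card_insert_of_notMem hmem]; omega, hA, ?_, hAj', ?_⟩
      · rw [Finset.coe_insert, Set.pairwise_insert]
        exact ⟨hB, fun x hx _ => ⟨by rw [dist_comm]; exact hBj x hx i le_rfl, hBj x hx i le_rfl⟩⟩
      · intro x hx c hc
        rcases Finset.mem_insert.1 hx with rfl | hx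
        · exact hnew c hc
        · exact hBj x hx c (hij.trans hc)

theorem card_le_coveringNumber {A : Finset X} {δ : ℝ≥0} (hδ : 2 * (δ : ℝ) < ε)
    (hA : (A : Set X).Pairwise (fun x y => ε ≤ dist x y)) :
    (A.card : ℕ∞) ≤ Metric.coveringNumber δ (univ : Set X) := by
  have hsep : Metric.IsSeparated ((2 * δ : ℝ≥0) : ℝ≥0∞) (A : Set X) := fun x hx y hy hxy => by
    show _ < edist x y
    rw [edist_dist, ENNReal.lt_ofReal_iff_toReal_lt ENNReal.coe_ne_top]
    simpa using hδ.trans_le (hA hx hy hxy)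
  have h := hsep.encard_le_packingNumber (subset_univ _)
  rw [Set.encard_coe_eq_coe_finsetCard] at h
  exact h.trans ((Metric.packingNumber_two_mul_le_externalCoveringNumber δ univ).trans
    (Metric.externalCoveringNumber_le_coveringNumber δ univ))

theorem Crossings.le_two_mul {N : ℕ} {δ : ℝ≥0} (hv : IsContour ρ v) (hε : 0 < ε)
    (hδ : 4 * (δ : ℝ) < ε) (hN : Metric.coveringNumber δ (univ : Set X) ≤ N)
    (h : Crossings v ε n j) : n ≤ 2 * N := by
  obtain ⟨A, B, hn, hA, hB, -, -⟩ := h.exists_separated hv hε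
  have h1 := (card_le_coveringNumber (by linarith) hA).trans hN
  have h2 := (card_le_coveringNumber (by linarith) hB).trans hN
  norm_cast at h1 h2
  omega

/-- A sequence with few crossings at every scale can be run with a clock that charges `a k` for
each increment of size `2⁻ᵏ`. -/
theorem exists_clock {a : ℕ → ℝ} {N : ℕ → ℕ} (ha : ∀ k, 0 ≤ a k)
    (hsum : Summable fun k => a k * N k)
    (hN : ∀ k n j, Crossings v ((1 / 2) ^ k) n j → n ≤ N k) :
    ∃ τ : ℕ → ℝ, Monotone τ ∧ (∀ j, 0 ≤ τ j) ∧ (∀ j, τ j ≤ ∑' k, a k * N k) ∧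
      ∀ k i j, i ≤ j → (1 / 2) ^ k ≤ dist (v i) (v j) → τ i + a k ≤ τ j := by
  -- ω k j is the maximal number of crossings of size 2⁻ᵏ up to time j. The clock is ∑ a k * ω k j;
  -- an increment of that size raises ω k by at least one.
  set ω : ℕ → ℕ → ℕ := fun k j => sSup {n | Crossings v ((1 / 2) ^ k) n j} with hω
  have hbdd : ∀ k j, BddAbove {n | Crossings v ((1 / 2) ^ k) n j} :=
    fun k j => ⟨N k, fun n hn => hN k n j hn⟩
  have hmem : ∀ k j, Crossings v ((1 / 2) ^ k) (ω k j) j :=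
    fun k j => Nat.sSup_mem ⟨0, Crossings.zero j⟩ (hbdd k j)
  have hωN : ∀ k j, ω k j ≤ N k := fun k j => hN k _ j (hmem k j)
  have hmono : ∀ k, Monotone (ω k) := fun k i j hij =>
    le_csSup (hbdd k j) ((hmem k i).mono hij)
  have hle : ∀ j k, a k * ω k j ≤ a k * N k := fun j k =>
    mul_le_mul_of_nonneg_left (by exact_mod_cast hωN k j) (ha k)
  have hs : ∀ j, Summable fun k => a k * ω k j := fun j =>
    hsum.of_nonneg_of_le (fun k => mul_nonneg (ha k) (by positivity)) (hle j)
  have hmono' : ∀ {i j}, i ≤ j → ∀ k, a k * ω k i ≤ a k * ω k j := fun hij k =>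
    mul_le_mul_of_nonneg_left (by exact_mod_cast hmono k hij) (ha k)
  refine ⟨fun j => ∑' k, a k * ω k j, fun i j hij => (hs i).tsum_le_tsum (hmono' hij) (hs j),
    fun j => tsum_nonneg fun k => mul_nonneg (ha k) (by positivity),
    fun j => (hs j).tsum_le_tsum (hle j) hsum, fun k i j hij hd => ?_⟩
  have hstep : ω k i + 1 ≤ ω k j := le_csSup (hbdd k j) ((hmem k i).succ hij hd)
  have hstep' : a k * ω k i + a k ≤ a k * ω k j := by
    have : ((ω k i + 1 : ℕ) : ℝ) ≤ ω k j := by exact_mod_cast hstep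
    push_cast at this
    nlinarith [ha k]
  have h1 := ((hs j).sub (hs i)).le_tsum k fun l _ => sub_nonneg.2 (hmono' hij l)
  rw [(hs j).tsum_sub (hs i)] at h1
  linarith

end Crossings

/-! ### Walks run with the clock, and their limit -/

section RTree

variable {T : Type*} [MetricSpace T] [CompactSpace T]

/-- Approximate contour explorations, with a modulus of continuity independent of the precision. -/
theorem IsRTree.exists_approx_contour (hT : IsRTree T) (ρ : T) {a : ℕ → ℝ} {N : ℕ → ℕ}
    (ha : ∀ k, 0 < a k) (hsum : Summable fun k => a k * N k)
    (hN : ∀ k, Metric.coveringNumber ((1 / 2) ^ (k + 3)) (univ : Set T) ≤ N k) {η : ℝ}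
    (hη : 0 < η) :
    ∃ g : I → T, IsContour ρ g ∧ (∀ x, ∃ t, dist x (g t) ≤ η) ∧
      ∀ k s t, s ≤ t → (1 / 2) ^ k + η ≤ dist (g s) (g t) →
        a k ≤ (2 * ∑' k, a k * N k + 1) * ((t : ℝ) - s) := by
  obtain ⟨v, M, hv, hstep, hdense⟩ := hT.exists_isContour ρ hη
  have hcr : ∀ k n j, Crossings v ((1 / 2) ^ k) n j → n ≤ 2 * N k := fun k n j h => by
    -- The exponent k + 3 gives 4 * 2⁻ᵏ⁻³ = 2⁻ᵏ / 2, strictly below 2⁻ᵏ.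
    refine h.le_two_mul (δ := (1 / 2) ^ (k + 3)) hv (by positivity) ?_ (hN k)
    push_cast
    rw [pow_add]
    have : (0 : ℝ) < (1 / 2) ^ k := by positivity
    linarith
  have hsum2 : HasSum (fun k => a k * ((2 * N k : ℕ) : ℝ)) (2 * ∑' k, a k * N k) := by
    simpa [mul_left_comm] using hsum.hasSum.mul_left 2
  obtain ⟨τ, hmono, h0, h1, hτ⟩ := exists_clock (fun k => (ha k).le) hsum2.summable hcr
  rw [hsum2.tsum_eq] at h1
  set K : ℝ := 2 * ∑' k, a k * N k + 1 with hK
  have hKpos : 0 < K := by linarith [h0 0, h1 0]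
  classical
  -- The walk is at the last index whose clock time is at most K t. The default value 0 of
  -- `Nat.findGreatest` explains the condition `ι t ≠ 0` in `hle`.
  set ι : I → ℕ := fun t => Nat.findGreatest (fun i => τ i ≤ K * t) M with hι
  have hιmono : Monotone ι := fun s t hst =>
    Nat.findGreatest_mono_left (fun i hi => hi.trans
      (mul_le_mul_of_nonneg_left (by exact_mod_cast hst) hKpos.le)) M
  have hle : ∀ t, ι t ≠ 0 → τ (ι t) ≤ K * t := fun t ht =>
    Nat.findGreatest_of_ne_zero (P := fun i => τ i ≤ K * t) rfl ht
  have hgt : ∀ t i, ι t < i → i ≤ M → K * t < τ i := fun t i h1 h2 =>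
    not_le.1 (Nat.findGreatest_is_greatest h1 h2)
  refine ⟨v ∘ ι, fun i j k hij hjk => hv (hιmono hij) (hιmono hjk), fun x => ?_, ?_⟩
  · obtain ⟨i, hiM, hi⟩ := hdense x
    have hmem : τ i / K ∈ I := ⟨div_nonneg (h0 i) hKpos.le,
      (div_le_one hKpos).2 (by linarith [h1 i])⟩
    refine ⟨⟨τ i / K, hmem⟩, ?_⟩
    have e : K * (τ i / K) = τ i := mul_div_cancel₀ _ hKpos.ne'
    have hi' : i ≤ ι ⟨τ i / K, hmem⟩ := Nat.le_findGreatest hiM e.ge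
    -- At time τ i / K the index may have passed i, but the clock has not advanced, and a positive
    -- displacement would have been charged.
    suffices h : dist (v i) (v (ι ⟨τ i / K, hmem⟩)) ≤ 0 by
      have := dist_triangle x (v i) (v (ι ⟨τ i / K, hmem⟩))
      simp only [Function.comp_apply]
      linarith
    refine le_of_not_gt fun hpos => ?_
    obtain ⟨k, hk⟩ := exists_pow_lt_of_lt_one hpos (by norm_num : (1 / 2 : ℝ) < 1)
    have h2 := hτ k _ _ hi' hk.le
    have h3 : τ (ι ⟨τ i / K, hmem⟩) ≤ τ i := by
      rcases eq_or_ne (ι ⟨τ i / K, hmem⟩) 0 with h | h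
      · rw [h]; exact hmono (Nat.zero_le i)
      · exact (hle _ h).trans e.le
    linarith [ha k]
  · intro k s t hst hd
    have hlt : ι s < ι t := by
      refine (hιmono hst).lt_of_ne fun h => ?_
      have : (0 : ℝ) < (1 / 2) ^ k := by positivity
      simp only [Function.comp_apply, h, dist_self] at hd
      linarith
    -- Only from index ι s + 1 on does the clock exceed K s. Dropping the first step costs at most
    -- η, hence the margin η in the modulus.
    have h2 := hgt s (ι s + 1) (Nat.lt_succ_self _) (hlt.trans_le (Nat.findGreatest_le M))
    have h3 := hle t (by omega)
    have h4 := dist_triangle (v (ι s)) (v (ι s + 1)) (v (ι t))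
    have h5 := hτ k (ι s + 1) (ι t) hlt (by
      simp only [Function.comp_apply] at hd
      linarith [hstep (ι s)])
    linarith

end RTree

section RTree

variable {T : Type*} [MetricSpace T]

/-- A compact `ℝ`-tree is explored by a contour, with an explicit modulus of continuity. -/
theorem IsRTree.exists_contour [CompactSpace T] (hT : IsRTree T) (ρ : T) {a : ℕ → ℝ} {N : ℕ → ℕ}
    (ha : ∀ k, 0 < a k) (hsum : Summable fun k => a k * N k)
    (hN : ∀ k, Metric.coveringNumber ((1 / 2) ^ (k + 3)) (univ : Set T) ≤ N k) :
    ∃ (g : I → T) (K : ℝ), 0 < K ∧ Function.Surjective g ∧ IsContour ρ g ∧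
      ∀ k s t, s ≤ t → (1 / 2) ^ k < dist (g s) (g t) → a k ≤ K * ((t : ℝ) - s) := by
  set K : ℝ := 2 * ∑' k, a k * N k + 1 with hK
  have hKpos : 0 < K := by
    have : 0 ≤ ∑' k, a k * N k := tsum_nonneg fun k => mul_nonneg (ha k).le (by positivity)
    linarith
  choose G hG hdense hmod using fun n : ℕ =>
    hT.exists_approx_contour ρ ha hsum hN (η := 1 / ((n : ℝ) + 1)) (by positivity)
  -- By compactness, an ultrafilter gives limits at all t simultaneously, without equicontinuity.
  set 𝒰 : Ultrafilter ℕ := hyperfilter ℕ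
  have hη : Tendsto (fun n : ℕ => 1 / ((n : ℝ) + 1)) 𝒰 (𝓝 0) :=
    tendsto_one_div_add_atTop_nhds_zero_nat.mono_left Nat.hyperfilter_le_atTop
  choose g hg using fun t : I =>
    show ∃ x, Tendsto (fun n => G n t) 𝒰 (𝓝 x) from
      ⟨_, (𝒰.map fun n => G n t).le_nhds_lim⟩
  have hgp : ∀ s t, Tendsto (fun n => gromovProduct ρ (G n s) (G n t)) 𝒰
      (𝓝 (gromovProduct ρ (g s) (g t))) := fun s t =>
    ((continuous_gromovProduct ρ).tendsto (g s, g t)).comp ((hg s).prodMk_nhds (hg t))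
  refine ⟨g, K, hKpos, fun x => ?_, fun i j k hij hjk =>
    ⟨le_of_tendsto_of_tendsto' (hgp i k) (hgp i j) fun n => (hG n hij hjk).1,
      le_of_tendsto_of_tendsto' (hgp i k) (hgp j k) fun n => (hG n hij hjk).2⟩,
    fun k s t hst hd => ?_⟩
  -- Times u n at which the walks are near x converge to t. If g t ≠ x, the walks move by a fixed
  -- amount between u n and t, which costs at least a k although K * |u n - t| tends to 0. One of
  -- the two η is the error at x, the other the margin of the modulus.
  · choose u hu using fun n => hdense n x
    obtain ⟨t, ht⟩ : ∃ t, Tendsto u 𝒰 (𝓝 t) := ⟨_, (𝒰.map u).le_nhds_lim⟩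
    refine ⟨t, ?_⟩
    by_contra hne
    obtain ⟨k, hk⟩ := exists_pow_lt_of_lt_one (dist_pos.2 hne) (by norm_num : (1 / 2 : ℝ) < 1)
    have h1 : Tendsto (fun n => dist (G n t) x - 2 * (1 / ((n : ℝ) + 1))) 𝒰
        (𝓝 (dist (g t) x - 2 * 0)) := ((hg t).dist tendsto_const_nhds).sub (hη.const_mul 2)
    have h2 : Tendsto (fun n => K * |((u n : ℝ) - t)|) 𝒰 (𝓝 (K * |(t : ℝ) - t|)) :=
      ((((continuous_subtype_val.tendsto t).comp ht).sub tendsto_const_nhds).abs).const_mul K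
    rw [mul_zero, sub_zero] at h1
    rw [sub_self, abs_zero, mul_zero] at h2
    obtain ⟨n, hn1, hn2⟩ := ((h1.eventually (lt_mem_nhds hk)).and
      (h2.eventually (gt_mem_nhds (ha k)))).exists
    have h3 := dist_triangle (G n t) (G n (u n)) x
    have h4 := hu n
    rw [dist_comm] at h4
    rcases le_total (u n) t with h | h
    · have := hmod n k _ _ h (by rw [dist_comm]; linarith)
      rw [abs_sub_comm, abs_of_nonneg (sub_nonneg.2 (by exact_mod_cast h))] at hn2
      linarith
    · have := hmod n k _ _ h (by linarith)
      rw [abs_of_nonneg (sub_nonneg.2 (by exact_mod_cast h))] at hn2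
      linarith
  · have h1 : Tendsto (fun n => dist (G n s) (G n t) - 1 / ((n : ℝ) + 1)) 𝒰
        (𝓝 (dist (g s) (g t) - 0)) := ((hg s).dist (hg t)).sub hη
    rw [sub_zero] at h1
    obtain ⟨n, hn⟩ := (h1.eventually (lt_mem_nhds hd)).exists
    exact hmod n k s t hst (by linarith)

/-! ### Recovering the tree from the height of its contour -/

/-- Along a path of an `ℝ`-tree, the distance to the root goes below the Gromov product of the
endpoints. -/
theorem IsRTree.iInf_dist_le_gromovProduct (hT : IsRTree T) (ρ : T) {x y : T} (γ : Path x y) :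
    ⨅ t : I, dist ρ (γ t) ≤ gromovProduct ρ x y := by
  refine le_of_forall_lt fun c hc => ?_
  obtain ⟨c', hcc', hc'⟩ := _root_.exists_between hc
  refine hcc'.trans_le ?_
  have hb : BddBelow (range fun t : I => dist ρ (γ t)) :=
    ⟨0, by rintro _ ⟨t, rfl⟩; exact dist_nonneg⟩
  have hc'' : ∀ t, c' < dist ρ (γ t) := fun t => hc'.trans_le (ciInf_le hb t)
  have hcont : ∀ z, Continuous fun t => gromovProduct ρ z (γ t) := fun z =>
    (continuous_gromovProduct ρ).comp (continuous_const.prodMk γ.continuous)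
  -- Openness: for s near t, (γ t|γ s) is close to dist ρ (γ t) > c', and the ultrametric inequality
  -- carries the bound from t to s.
  have hclopen : IsClopen {t : I | c' ≤ gromovProduct ρ x (γ t)} := by
    refine ⟨isClosed_le continuous_const (hcont x), isOpen_iff_mem_nhds.2 fun t ht => ?_⟩
    have : ∀ᶠ s in 𝓝 t, c' < gromovProduct ρ (γ t) (γ s) :=
      ((hcont (γ t)).tendsto t).eventually (lt_mem_nhds (by rw [gromovProduct_self]; exact hc'' t))
    filter_upwards [this] with s hs
    exact (le_min ht hs.le).trans (hT.min_gromovProduct_le ρ x (γ t) (γ s))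
  have huniv := hclopen.eq_univ ⟨0, by simpa [gromovProduct_self] using (hc'' 0).le⟩
  simpa using (huniv ▸ mem_univ (1 : I) : (1 : I) ∈ {t : I | c' ≤ gromovProduct ρ x (γ t)})

/-- The upper bound concerns image paths in T. The segment from s to t attains it: the contour
relation gives (g s|g t) ≤ dist ρ (g u) for u between them. -/
theorem IsRTree.pathHeight_eq_gromovProduct (hT : IsRTree T) {ρ : T} {g : C(I, T)}
    (hg : IsContour ρ g) {f : C(I, ℝ)} (hf : ∀ t, f t = dist ρ (g t)) (s t : I) :
    pathHeight f s t = gromovProduct ρ (g s) (g t) := by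
  refine le_antisymm (ciSup_le fun γ => ?_) ?_
  · simpa [hf] using hT.iInf_dist_le_gromovProduct ρ (γ.map g.continuous)
  · let γ : Path s t := ⟨⟨Icc.convexComb s t, by fun_prop⟩, by simp, by simp⟩
    refine le_trans (le_ciInf fun u => ?_) (le_pathHeight f γ)
    have hu : γ u ∈ uIcc s t := by
      rw [← Path.range_subpathAux s t]; exact mem_range_self u
    rw [hf]
    rcases mem_uIcc.1 hu with ⟨h1, h2⟩ | ⟨h1, h2⟩
    · exact (hg h1 h2).1.trans (gromovProduct_le_right ρ _ _)
    · exact (hg h1 h2).symm.1.trans (gromovProduct_le_right ρ _ _)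

theorem IsRTree.nonempty_isometryEquiv_h0Tree (hT : IsRTree T) {ρ : T} {g : C(I, T)}
    (hg : IsContour ρ g) (hsurj : Function.Surjective g) {f : C(I, ℝ)}
    (hf : ∀ t, f t = dist ρ (g t)) : Nonempty (T ≃ᵢ H0Tree f) := by
  have hI : ∀ s t : I, dist (g s) (g t) = h0Dist f s t := fun s t => by
    rw [h0Dist, hT.pathHeight_eq_gromovProduct hg hf, hf, hf, dist_eq_gromovProduct ρ]
  have hdist : ∀ s t : H0Space f, dist (g s) (g t) = dist s t := hI
  let F : H0Tree f → T := SeparationQuotient.lift (fun s : H0Space f => g s) fun s t hst => by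
    rw [← dist_eq_zero, hdist]; exact Metric.inseparable_iff.1 hst
  have hF : Isometry F := by
    refine Isometry.of_dist_eq fun x y => ?_
    obtain ⟨x, rfl⟩ := SeparationQuotient.surjective_mk x
    obtain ⟨y, rfl⟩ := SeparationQuotient.surjective_mk y
    exact hdist x y
  have hFs : Function.Surjective F := fun x => by
    obtain ⟨t, rfl⟩ := hsurj x
    exact ⟨SeparationQuotient.mk (t : H0Space f), rfl⟩
  exact ⟨(IsometryEquiv.mk (Equiv.ofBijective F ⟨hF.injective, hFs⟩) hF).symm⟩

end RTree

/-! ### Box dimension and the weights of the clock -/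

section BoxDimension

variable {X : Type*} [PseudoMetricSpace X]

theorem coveringNumber_ne_top_of_compactSpace [CompactSpace X] {ε : ℝ≥0} (hε : 0 < ε) :
    Metric.coveringNumber ε (univ : Set X) ≠ ⊤ := by
  obtain ⟨S, -, hSf, hS⟩ := (isCompact_univ (X := X)).finite_cover_balls
    (show (0 : ℝ) < ε from hε)
  have hcov : Metric.IsCover ε (univ : Set X) S := fun x _ => by
    obtain ⟨y, hy, hxy⟩ := mem_iUnion₂.1 (hS (mem_univ x))
    refine ⟨y, hy, ?_⟩
    show edist x y ≤ ε
    rw [edist_nndist]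
    exact_mod_cast (Metric.mem_ball.1 hxy).le
  exact ((hcov.coveringNumber_le_encard (subset_univ _)).trans_lt hSf.encard_lt_top).ne

theorem eventually_coveringNumber_le [CompactSpace X] [Nonempty X] {p : ℝ}
    (hp : upperBoxDim X < p) :
    ∀ᶠ ε : ℝ≥0 in 𝓝[>] 0,
      ((Metric.coveringNumber ε (univ : Set X)).toNat : ℝ) ≤ (1 / (ε : ℝ)) ^ p := by
  have h1 : ∀ᶠ ε : ℝ≥0 in 𝓝[>] 0, ε ∈ Ioo 0 1 := Ioo_mem_nhdsGT one_pos
  filter_upwards [eventually_lt_of_limsup_lt hp, h1] with ε hε ⟨h0, h1⟩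
  have hfin := coveringNumber_ne_top_of_compactSpace (X := X) h0
  obtain ⟨n, hn⟩ := ENat.ne_top_iff_exists.1 hfin
  have hpos : 0 < n := by
    have : 0 < Metric.coveringNumber ε (univ : Set X) :=
      Metric.coveringNumber_pos_iff.2 univ_nonempty
    rw [← hn] at this
    exact_mod_cast this
  have hn' : (0 : ℝ) < n := by exact_mod_cast hpos
  rw [← hn] at hε ⊢
  have hlog : ENNReal.log (((n : ℕ∞) : ℝ≥0∞)) = (Real.log n : ℝ) := by
    rw [← ENNReal.log_ofReal_of_pos hn']; simp
  have hε0 : (0 : ℝ) < ε := h0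
  have hL : 0 < Real.log (1 / (ε : ℝ)) :=
    Real.log_pos ((one_lt_div hε0).2 (by exact_mod_cast h1))
  rw [hlog, ← EReal.coe_div, EReal.coe_lt_coe_iff, div_lt_iff₀ hL] at hε
  rw [ENat.toNat_natCast, ← Real.log_le_log_iff hn' (by positivity), Real.log_rpow (by positivity)]
  exact hε.le

theorem upperBoxDim_nonneg [Nonempty X] : 0 ≤ upperBoxDim X := by
  have h1 : ∀ᶠ ε : ℝ≥0 in 𝓝[>] 0, ε ∈ Ioo 0 1 := Ioo_mem_nhdsGT one_pos
  refine le_limsup_of_frequently_le' (Eventually.frequently ?_)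
  filter_upwards [h1] with ε ⟨h0, h1⟩
  refine EReal.div_nonneg ?_ ?_
  · rw [ENNReal.zero_le_log_iff]
    have : 1 ≤ Metric.coveringNumber ε (univ : Set X) :=
      Order.one_le_iff_pos.2 (Metric.coveringNumber_pos_iff.2 univ_nonempty)
    exact_mod_cast this
  · exact_mod_cast Real.log_nonneg
      ((one_le_div (show (0 : ℝ) < ε from h0)).2 (by exact_mod_cast h1.le))

/-- The weight given to an increment of size `2⁻ᵏ` by the clock of the contour. -/
def scaleWeight (X : Type*) [PseudoMetricSpace X] (k : ℕ) : ℝ :=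
  1 / ((k + 1) ^ 2 * ((Metric.coveringNumber ((1 / 2) ^ (k + 3)) (univ : Set X)).toNat + 1))

theorem scaleWeight_pos (k : ℕ) : 0 < scaleWeight X k := by
  unfold scaleWeight; positivity

theorem summable_scaleWeight_mul :
    Summable fun k => scaleWeight X k *
      (Metric.coveringNumber ((1 / 2) ^ (k + 3)) (univ : Set X)).toNat := by
  have h : Summable fun k : ℕ => 1 / ((k + 1 : ℕ) : ℝ) ^ 2 :=
    (summable_nat_add_iff 1).2 (Real.summable_one_div_nat_pow.2 one_lt_two)
  refine h.of_nonneg_of_le (fun k => 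
    mul_nonneg (scaleWeight_pos k).le (Nat.cast_nonneg _)) fun k => ?_
  rw [scaleWeight, Nat.cast_succ, div_mul_eq_mul_div, one_mul,
    div_le_div_iff₀ (by positivity) (by positivity), one_mul, mul_comm]
  gcongr
  exact le_add_of_nonneg_right zero_le_one

/-- With q strictly between the dimension and p, the ratio of the two sides is O((k+1)²
2^(-k(p-q))), hence bounded; positivity of the weights absorbs the first few k. -/
theorem exists_rpow_le_scaleWeight [CompactSpace X] [Nonempty X] {p : ℝ} (hp : 0 < p)
    (hdim : upperBoxDim X < p) : ∃ C : ℝ, 0 < C ∧ ∀ k, ((1 / 2 : ℝ) ^ k) ^ p ≤ C * scaleWeight X k := by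
  -- q is also taken positive, so that 2^(kq) ≥ 1 absorbs the + 1 in the weight.
  obtain ⟨q, hq0, hq⟩ := EReal.lt_iff_exists_real_btwn.1
    (max_lt hdim (show (0 : EReal) < p by exact_mod_cast hp))
  obtain ⟨hdq, hq0⟩ := max_lt_iff.1 hq0
  rw [EReal.coe_lt_coe_iff] at hq
  have hq0 : 0 < q := by exact_mod_cast hq0
  set r : ℝ := (1 / 2) ^ (p - q) with hr
  have hr1 : r < 1 := Real.rpow_lt_one (by norm_num) (by norm_num) (by linarith)
  have hr0 : 0 < r := by positivity
  set N : ℕ → ℕ := fun k => (Metric.coveringNumber ((1 / 2) ^ (k + 3)) (univ : Set X)).toNat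
    with hN
  have htend : Tendsto (fun k : ℕ => ((1 / 2 : ℝ≥0)) ^ (k + 3)) atTop (𝓝[>] 0) := by
    refine tendsto_nhdsWithin_iff.2 ⟨?_, Eventually.of_forall fun k =>
      show (0 : ℝ≥0) < (1 / 2) ^ (k + 3) by positivity⟩
    exact (tendsto_add_atTop_iff_nat 3).2
      (tendsto_pow_atTop_nhds_zero_of_lt_one (by norm_num) (by
        rw [← NNReal.coe_lt_coe]; norm_num))
  have hcov : ∀ᶠ k in atTop, (N k : ℝ) ≤ 8 ^ q * ((2 : ℝ) ^ k) ^ q := by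
    filter_upwards [htend.eventually (eventually_coveringNumber_le hdq)] with k hk
    refine hk.trans (le_of_eq ?_)
    rw [← Real.mul_rpow (by positivity) (by positivity)]
    congr 1
    push_cast
    rw [one_div_pow, one_div_one_div, pow_add]
    norm_num [mul_comm]
  have hO : (fun k => ((1 / 2 : ℝ) ^ k) ^ p) =O[atTop] scaleWeight X := by
    have hlim : Tendsto (fun k : ℕ => ((k + 1 : ℕ) : ℝ) ^ 2 * r ^ (k + 1)) atTop (𝓝 0) :=
      (tendsto_add_atTop_iff_nat 1).2
        (tendsto_pow_const_mul_const_pow_of_abs_lt_one 2 (by rwa [abs_of_pos hr0]))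
    refine Asymptotics.IsBigO.of_bound ((8 ^ q + 1) / r) ?_
    filter_upwards [hcov, hlim.eventually (gt_mem_nhds one_pos)] with k hk hk'
    rw [Real.norm_of_nonneg (by positivity), Real.norm_of_nonneg (scaleWeight_pos k).le,
      scaleWeight, mul_one_div, le_div_iff₀ (by positivity)]
    have hx : (1 : ℝ) ≤ ((2 : ℝ) ^ k) ^ q := Real.one_le_rpow (one_le_pow₀ one_le_two) hq0.le
    have e : ((1 / 2 : ℝ) ^ k) ^ p * ((2 : ℝ) ^ k) ^ q = r ^ k := by
      rw [← Real.rpow_pow_comm (by norm_num), ← Real.rpow_pow_comm (by norm_num), ← mul_pow, hr,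
        Real.rpow_sub (by norm_num), one_div, Real.inv_rpow (by norm_num) q, div_inv_eq_mul]
    have hN1 : (N k : ℝ) + 1 ≤ (8 ^ q + 1) * ((2 : ℝ) ^ k) ^ q := by linarith
    calc ((1 / 2 : ℝ) ^ k) ^ p * (((k : ℝ) + 1) ^ 2 * ((N k : ℝ) + 1))
        ≤ ((1 / 2 : ℝ) ^ k) ^ p * (((k : ℝ) + 1) ^ 2 * ((8 ^ q + 1) * ((2 : ℝ) ^ k) ^ q)) := by
          gcongr
      _ = (8 ^ q + 1) * ((k : ℝ) + 1) ^ 2 * (((1 / 2 : ℝ) ^ k) ^ p * ((2 : ℝ) ^ k) ^ q) := by ring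
      _ = (8 ^ q + 1) / r * (((k + 1 : ℕ) : ℝ) ^ 2 * r ^ (k + 1)) := by
          rw [e, pow_succ r]
          push_cast
          field_simp
      _ ≤ (8 ^ q + 1) / r := mul_le_of_le_one_right (by positivity) hk'.le
  obtain ⟨C, hC, h⟩ := Asymptotics.bound_of_isBigO_nat_atTop hO
  refine ⟨C, hC, fun k => ?_⟩
  have := h (scaleWeight_pos k).ne'
  rwa [Real.norm_of_nonneg (by positivity), Real.norm_of_nonneg (scaleWeight_pos k).le] at this

end BoxDimension

/-! ### Hölder regularity and conclusion -/

theorem pVariation_lt_top_of_holderWith {p : ℝ} (hp : 0 < p) {C : ℝ≥0} {f : I → ℝ}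
    (hf : HolderWith C (Real.toNNReal (1 / p)) f) : pVariation p f < ⊤ := by
  have hbound : ∀ D : ℕ × {t : ℕ → I // Monotone t},
      ∑ k ∈ Finset.range D.1, edist (f (D.2.1 (k + 1))) (f (D.2.1 k)) ^ p ≤ (C : ℝ≥0∞) ^ p := by
    rintro ⟨n, t, ht⟩
    have hnn : ∀ k, 0 ≤ (t (k + 1) : ℝ) - t k := fun k =>
      sub_nonneg.2 (by exact_mod_cast ht (Nat.le_succ k))
    have hstep : ∀ k, edist (f (t (k + 1))) (f (t k)) ^ p ≤
        (C : ℝ≥0∞) ^ p * ENNReal.ofReal ((t (k + 1) : ℝ) - t k) := fun k => by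
      refine (ENNReal.rpow_le_rpow (hf (t (k + 1)) (t k)) hp.le).trans (le_of_eq ?_)
      rw [ENNReal.mul_rpow_of_nonneg _ _ hp.le, ← ENNReal.rpow_mul,
        Real.coe_toNNReal _ (by positivity), one_div_mul_cancel hp.ne', ENNReal.rpow_one,
        edist_dist, Subtype.dist_eq, Real.dist_eq, abs_of_nonneg (hnn k)]
    calc ∑ k ∈ Finset.range n, edist (f (t (k + 1))) (f (t k)) ^ p
        ≤ ∑ k ∈ Finset.range n, (C : ℝ≥0∞) ^ p * ENNReal.ofReal ((t (k + 1) : ℝ) - t k) :=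
          Finset.sum_le_sum fun k _ => hstep k
      _ = (C : ℝ≥0∞) ^ p * ENNReal.ofReal ((t n : ℝ) - t 0) := by
          rw [← Finset.mul_sum, ← ENNReal.ofReal_sum_of_nonneg
            fun k _ => hnn k,
            Finset.sum_range_sub (fun k => (t k : ℝ))]
      _ ≤ (C : ℝ≥0∞) ^ p * 1 := by
          gcongr
          rw [← ENNReal.ofReal_one]
          exact ENNReal.ofReal_le_ofReal (by linarith [(t n).2.2, (t 0).2.1])
      _ = _ := mul_one _
  refine ENNReal.rpow_lt_top_of_nonneg (by positivity) (ne_of_lt ?_)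
  exact (iSup_le hbound).trans_lt (ENNReal.rpow_lt_top_of_nonneg hp.le ENNReal.coe_ne_top)

theorem holderWith_of_dist_rpow_le {X Y : Type*} [PseudoMetricSpace X] [PseudoMetricSpace Y]
    {p C : ℝ} (hp : 0 < p) {g : X → Y} (hg : ∀ s t, dist (g s) (g t) ^ p ≤ C * dist s t) :
    HolderWith (Real.toNNReal C ^ (1 / p)) (Real.toNNReal (1 / p)) g := by
  intro s t
  have h : edist (g s) (g t) ^ p ≤ (Real.toNNReal C : ℝ≥0∞) * edist s t := by
    rw [edist_dist, edist_dist, ENNReal.ofReal_rpow_of_nonneg dist_nonneg hp.le,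
      ← ENNReal.ofReal, ← ENNReal.ofReal_mul' dist_nonneg]
    exact ENNReal.ofReal_le_ofReal (hg s t)
  rw [Real.coe_toNNReal _ (by positivity), ENNReal.coe_rpow_of_nonneg _ (by positivity),
    ← ENNReal.mul_rpow_of_nonneg _ _ (by positivity)]
  have := ENNReal.rpow_le_rpow h (show 0 ≤ 1 / p by positivity)
  rwa [← ENNReal.rpow_mul, mul_one_div_cancel hp.ne', ENNReal.rpow_one] at this

/-- Take the least k with 2⁻ᵏ < d. If k > 0, minimality gives d ≤ 2 * 2⁻ᵏ; if k = 0, the bound is d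
≤ D. -/
theorem exists_scale {d D : ℝ} (hd : 0 < d) (h2 : 2 ≤ D) (hD : d ≤ D) :
    ∃ k : ℕ, (1 / 2) ^ k < d ∧ d ≤ D * (1 / 2) ^ k := by
  classical
  have hex := exists_pow_lt_of_lt_one hd (by norm_num : (1 / 2 : ℝ) < 1)
  refine ⟨Nat.find hex, Nat.find_spec hex, ?_⟩
  rcases h : Nat.find hex with _ | k
  · simpa using hD
  · have := not_lt.1 (Nat.find_min hex (m := k) (by omega))
    rw [pow_succ]
    nlinarith [show (0 : ℝ) < (1 / 2) ^ k by positivity]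

/-- The weights do not depend on p, so a single contour serves all exponents. -/
theorem IsRTree.exists_holder_contour {T : Type*} [MetricSpace T] [CompactSpace T]
    (hT : IsRTree T) (ρ : T) : ∃ g : I → T, Function.Surjective g ∧ IsContour ρ g ∧
      ∀ p : ℝ, 0 < p → upperBoxDim T < p → ∃ C : ℝ≥0, HolderWith C (Real.toNNReal (1 / p)) g := by
  have : Nonempty T := ⟨ρ⟩
  obtain ⟨g, K, hK, hsurj, hg, hmod⟩ := hT.exists_contour ρ (scaleWeight_pos (X := T))
    summable_scaleWeight_mul fun k => (ENat.natCast_toNat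
      (coveringNumber_ne_top_of_compactSpace (by positivity))).ge
  refine ⟨g, hsurj, hg, fun p hp hdim => ?_⟩
  obtain ⟨C, hC, hCw⟩ := exists_rpow_le_scaleWeight hp hdim
  set D : ℝ := max 2 (Metric.diam (univ : Set T))
  have key : ∀ s t : I, s ≤ t → dist (g s) (g t) ^ p ≤ D ^ p * (C * K) * dist s t := by
    intro s t hst
    have hD0 : 0 < D := two_pos.trans_le (le_max_left _ _)
    rcases (dist_nonneg (x := g s) (y := g t)).eq_or_lt with h | h
    · rw [← h, Real.zero_rpow hp.ne']; positivity
    obtain ⟨k, hk1, hk2⟩ := exists_scale h (le_max_left _ _) ((Metric.dist_le_diam_of_mem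
      isCompact_univ.isBounded (mem_univ (g s)) (mem_univ (g t))).trans (le_max_right _ _) :
        dist (g s) (g t) ≤ D)
    have e : (t : ℝ) - s = dist s t := by
      rw [Subtype.dist_eq, Real.dist_eq, abs_sub_comm,
        abs_of_nonneg (sub_nonneg.2 (by exact_mod_cast hst))]
    calc dist (g s) (g t) ^ p ≤ (D * (1 / 2) ^ k) ^ p := by gcongr
      _ = D ^ p * ((1 / 2) ^ k) ^ p := Real.mul_rpow hD0.le (by positivity)
      _ ≤ D ^ p * (C * (K * dist s t)) := by
          have := hmod k s t hst hk1
          rw [e] at this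
          gcongr
          exact (hCw k).trans (by gcongr)
      _ = D ^ p * (C * K) * dist s t := by ring
  refine ⟨_, holderWith_of_dist_rpow_le (C := D ^ p * (C * K)) hp fun s t => ?_⟩
  rcases le_total s t with h | h
  · exact key s t h
  · rw [dist_comm (g s), dist_comm s]; exact key t s h

end

theorem mainTheorem7 {T : Type*} [MetricSpace T] [CompactSpace T] (hT : IsRTree T)
    (hdim : upperBoxDim T < ⊤) :
    ∃ f : C(I, ℝ), Nonempty (T ≃ᵢ H0Tree f) ∧
      ∀ δ : ℝ, 0 < δ →
        pVariation ((upperBoxDim T).toReal + δ) f < ⊤ ∧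
        ∃ φ : I ≃ₜ I,
          Nonempty (T ≃ᵢ H0Tree (f.comp (φ : C(I, I)))) ∧
          ∃ C : ℝ≥0,
            HolderWith C (Real.toNNReal (1 / ((upperBoxDim T).toReal + δ))) (f ∘ φ) := by
  have hne : Nonempty T := hT.connected.toNonempty
  have ρ : T := Classical.arbitrary T
  have h0 : 0 ≤ upperBoxDim T := upperBoxDim_nonneg
  have hcoe : ((upperBoxDim T).toReal : EReal) = upperBoxDim T :=
    EReal.coe_toReal hdim.ne (ne_bot_of_le_ne_bot EReal.zero_ne_bot h0)
  have hdim_lt : ∀ δ : ℝ, 0 < δ → upperBoxDim T < ((upperBoxDim T).toReal + δ : ℝ) := by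
    intro δ hδ
    conv_lhs => rw [← hcoe]
    exact_mod_cast lt_add_of_pos_right _ hδ
  have hp : ∀ δ : ℝ, 0 < δ → 0 < (upperBoxDim T).toReal + δ := fun δ hδ =>
    add_pos_of_nonneg_of_pos (EReal.toReal_nonneg h0) hδ
  obtain ⟨g, hsurj, hg, hhol⟩ := hT.exists_holder_contour ρ
  have hgc : Continuous g := by
    obtain ⟨C, hC⟩ := hhol _ (hp 1 one_pos) (hdim_lt 1 one_pos)
    exact hC.continuous (Real.toNNReal_pos.2 (one_div_pos.2 (hp 1 one_pos)))
  let f : C(I, ℝ) := ⟨fun t => dist ρ (g t), by fun_prop⟩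
  have hiso : Nonempty (T ≃ᵢ H0Tree f) :=
    hT.nonempty_isometryEquiv_h0Tree (g := ⟨g, hgc⟩) hg hsurj fun _ => rfl
  refine ⟨f, hiso, fun δ hδ => ?_⟩
  obtain ⟨C, hC⟩ := hhol _ (hp δ hδ) (hdim_lt δ hδ)
  have hfC : HolderWith C (Real.toNNReal (1 / ((upperBoxDim T).toReal + δ))) f := fun s t => by
    refine le_trans ?_ (hC s t)
    exact (LipschitzWith.dist_right ρ).edist_le_mul (g s) (g t) |>.trans (by simp)
  -- The clock is already built into g, so no further change of time is needed.
  exact ⟨pVariation_lt_top_of_holderWith (hp δ hδ) hfC, Homeomorph.refl I, hiso, C, hfC⟩
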